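/- Let $\ell$ be an odd prime and let $H_\ell(x)=\sum_{k=0}^{(\ell-1)/2}\binom{(\ell-1)/2}{k}^2x^k\in\mathbb{F}_\ell[x]$ be the Deuring polynomial. Let $a\in\mathbb{F}_\ell$ be such that $x^2-x+a$ divides $H_\ell(x)$ in $\mathbb{F}_\ell[x]$. Then $a\neq 0$, and the equation $$y^2=x^3+\frac{1-a}{a}x^2+\frac{1-a}{a}x+1$$ defines a supersingular elliptic curve over $\mathbb{F}_\ell$; that is, it is nonsingular (its discriminant is nonzero) and the resulting elliptic curve has no nontrivial $\ell$-torsion point over $\overline{\mathbb{F}}_\ell$. Moreover, $x^2-x+a$ has a root in $\overline{\mathbb{F}}_\ell$, and for every root $\lambda\in\overline{\mathbb{F}}_\ell$ of $x^2-x+a$ one has $H_\ell(\lambda)=0$, $\lambda\neq 0,1$, and the curve is transformed by an admissible change of Weierstrass coordinates over $\overline{\mathbb{F}}_\ell$ into the Legendre form $y^2=x(x-1)(x-\lambda)$. -/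

import Mathlib

open Polynomial

/-- The Deuring polynomial `H_ℓ(x) = ∑_{k=0}^{(ℓ-1)/2} binom((ℓ-1)/2, k)² x^k` over `𝔽_ℓ`
(for an odd prime `ℓ`). -/
noncomputable def deuringPolynomial (ℓ : ℕ) : (ZMod ℓ)[X] :=
  ∑ k ∈ Finset.range ((ℓ - 1) / 2 + 1), C ((((ℓ - 1) / 2).choose k : ZMod ℓ) ^ 2) * X ^ k

/-- The Weierstrass curve in Legendre form `y² = x(x - 1)(x - lam)`,
that is `y² = x³ - (1 + lam)x² + lam x`. -/
def legendreCurve {K : Type*} [Field K] (lam : K) : WeierstrassCurve K where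
  a₁ := 0
  a₂ := -(1 + lam)
  a₃ := 0
  a₄ := lam
  a₆ := 0

/-- The symmetric Weierstrass curve `y² = x³ + b x² + b x + 1`. -/
def symmetricCurve {K : Type*} [Field K] (b : K) : WeierstrassCurve K where
  a₁ := 0
  a₂ := b
  a₃ := 0
  a₄ := b
  a₆ := 1

open Classical in
/-- A Weierstrass curve `E` over a field `F` of prime characteristic `p` is a supersingular
elliptic curve if it is nonsingular (its discriminant is a unit) and it has no nontrivial
`p`-torsion point over the algebraic closure of `F`. -/
structure IsSupersingularEllipticCurve (p : ℕ) {F : Type*} [Field F] [Fact p.Prime] [CharP F p]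
    (E : WeierstrassCurve F) : Prop where
  isElliptic : E.IsElliptic
  torsion_trivial :
    ∀ P : (E.baseChange (AlgebraicClosure F)).toAffine.Point, p • P = 0 → P = 0

/-! Write ℓ = 2n + 1. The coefficient of x^(ℓ-1) in (x(x-1)(x-λ))^n is (-1)^n H_ℓ(λ), so it vanishes
at a root of x² - x + a. Since 3n < 2ℓ - 1, this is the only coefficient obstructing an
antiderivative, and a linear substitution carries the antiderivative over to f^n, where y² = f(x) is
the symmetric curve.

Let D = 2y d/dx. A nonzero ℓ-torsion point has a maximal ideal I with I^ℓ = (g). In characteristic ℓ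
this gives g ∣ Dg, and comparing pole orders at infinity gives Dg = cg. If w' = f^n, then Dw = 2y^ℓ
is killed by D. As D^ℓ is a derivation, hence proportional to D, it must vanish, so c^ℓ = 0 and Dg =
0. Degree bounds then make g a polynomial in x associated to 1 or to (x - x₀)^ℓ, and both are
impossible (`XYIdeal_pow_ne_span`).

Nonsingularity amounts to a ≠ 0 and 1 - 4a ≠ 0. The first follows from H_ℓ(0) = 1. If 4a = 1, then
1/2 would be a double root of H_ℓ, which its hypergeometric equation forbids, 1/2 being an ordinary
point of that equation. -/

namespace Ideal

variable {A : Type*} [CommRing A]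

/-- In each term I^i J^(2n-i) of the binomial expansion, one of the two exponents is at least n. -/
theorem sup_pow_add_self_le (I J : Ideal A) (n : ℕ) :
    (I ⊔ J) ^ (n + n) ≤ (I ^ n ⊔ J ^ n) * (I ⊔ J) ^ n := by
  simp only [← Ideal.add_eq_sup]
  rw [add_pow, Ideal.sum_eq_sup]
  refine Finset.sup_le fun i hi => ?_
  refine Ideal.mul_le_left.trans ?_
  rcases le_total n i with h | h
  · obtain ⟨k, rfl⟩ := Nat.exists_eq_add_of_le h
    have hk : k + (n + n - (n + k)) = n := by have := Finset.mem_range.1 hi; omega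
    rw [pow_add, mul_assoc]
    refine Ideal.mul_mono le_sup_left ?_
    conv_rhs => rw [← hk, pow_add]
    exact Ideal.mul_mono (Ideal.pow_right_mono le_sup_left _) (Ideal.pow_right_mono le_sup_right _)
  · have hk : n + n - i = n + (n - i) := by omega
    rw [hk, pow_add, mul_left_comm]
    refine Ideal.mul_mono le_sup_right ?_
    conv_rhs => rw [show n = i + (n - i) by omega, pow_add]
    exact Ideal.mul_mono (Ideal.pow_right_mono le_sup_left _) (Ideal.pow_right_mono le_sup_right _)

end Ideal

/-! ### Derivations in characteristic p -/

namespace Derivation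

variable {K A : Type*} [CommRing K] [CommRing A] [Algebra K A]

open Finset in
/-- The general Leibniz rule for the iterates of a derivation. -/
theorem iterate_mul (D : Derivation K A A) (n : ℕ) (a b : A) :
    D^[n] (a * b) =
      ∑ ij ∈ antidiagonal n, n.choose ij.1 • (D^[ij.1] a * D^[ij.2] b) := by
  induction n with
  | zero => simp
  | succ n ih =>
    rw [Finset.sum_antidiagonal_choose_succ_nsmul (M := A) (fun i j => D^[i] a * D^[j] b) n]
    simp only [Function.iterate_succ_apply', ih, map_sum, map_nsmul, leibniz, smul_add,
      Finset.sum_add_distrib, smul_eq_mul, add_right_inj]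
    refine Finset.sum_congr rfl fun ⟨i, j⟩ hij ↦ ?_
    rw [n.choose_symm_of_eq_add (HasAntidiagonal.mem_antidiagonal.1 hij).symm, mul_comm]

/-- In characteristic `p`, the `p`-th iterate of a derivation is a derivation. -/
def iterateChar (D : Derivation K A A) (p : ℕ) [Fact p.Prime] [CharP A p] : Derivation K A A :=
  Derivation.mk' ((D : A →ₗ[K] A) ^ p) fun a b => by
    have hp : p.Prime := Fact.out
    simp only [Module.End.pow_apply, coeFn_coe, smul_eq_mul]
    rw [iterate_mul, Finset.Nat.sum_antidiagonal_eq_sum_range_succ_mk, Finset.sum_range_succ,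
      Finset.sum_eq_single_of_mem 0 (Finset.mem_range.2 hp.pos)]
    · simp
      ring
    · intro k hk hk0
      have : ((p.choose k : ℕ) : A) = 0 := (CharP.cast_eq_zero_iff A p _).2
        (hp.dvd_choose_self hk0 (Finset.mem_range.1 hk))
      simp [this]

@[simp]
theorem iterateChar_apply (D : Derivation K A A) (p : ℕ) [Fact p.Prime] [CharP A p] (a : A) :
    D.iterateChar p a = D^[p] a := by
  simp [iterateChar, Module.End.pow_apply]

theorem map_pow_char (D : Derivation K A A) (p : ℕ) [CharP A p] (a : A) : D (a ^ p) = 0 := by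
  rw [D.leibniz_pow, nsmul_eq_mul, CharP.cast_eq_zero, zero_mul]

/-- In characteristic `p`, a generator of `⟨u, v⟩ ^ p` divides its derivatives. -/
theorem dvd_apply_of_span_pair_pow [IsDomain A] (D : Derivation K A A) {p : ℕ} [CharP A p]
    {u v g : A} (hg : g ≠ 0) (h : Ideal.span {u, v} ^ p = Ideal.span {g}) : g ∣ D g := by
  have hdvd : ∀ z ∈ ({u, v} : Set A), g ∣ z ^ p := fun z hz => by
    rw [← Ideal.mem_span_singleton, ← h]
    exact Ideal.pow_mem_pow (Ideal.subset_span hz) p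
  have hu : g ∣ u ^ p := hdvd u (by simp)
  have hv : g ∣ v ^ p := hdvd v (by simp)
  -- With I = (u, v), g² lies in I^(2p) ⊆ (u^p, v^p)(g). Cancelling g leaves g ∈ (u^p, v^p), whose
  -- generators are constants for D.
  have hmem : g * g ∈ (Ideal.span {u ^ p} ⊔ Ideal.span {v ^ p}) * Ideal.span {g} := by
    have := Ideal.sup_pow_add_self_le (Ideal.span {u}) (Ideal.span {v}) p
    rw [← Ideal.span_insert, pow_add, h, Ideal.span_singleton_pow, Ideal.span_singleton_pow] at this
    exact this (Ideal.mul_mem_mul (Ideal.mem_span_singleton_self g)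
      (Ideal.mem_span_singleton_self g))
  obtain ⟨z, hz, hzg⟩ := Ideal.mem_mul_span_singleton.1 hmem
  rw [mul_right_cancel₀ hg hzg, ← Ideal.span_insert, Ideal.mem_span_pair] at hz
  obtain ⟨a, b, hab⟩ := hz
  have hD : D g = u ^ p * D a + v ^ p * D b := by
    rw [← hab, map_add, D.leibniz, D.leibniz, map_pow_char, map_pow_char]
    simp
  rw [hD]
  exact dvd_add (hu.mul_right _) (hv.mul_right _)

end Derivation

/-! ### The derivation 2y d/dx on y² = f(x) -/

namespace WeierstrassCurve.Affine

variable {K : Type*} [Field K] (W : Affine K)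

/-- The right hand side `x³ + a₂x² + a₄x + a₆` of the Weierstrass equation. -/
noncomputable def cubic : K[X] := X ^ 3 + C W.a₂ * X ^ 2 + C W.a₄ * X + C W.a₆

namespace CoordinateRing

variable {W}

theorem mul_smul_basis (h₁ : W.a₁ = 0) (h₃ : W.a₃ = 0) (p q r s : K[X]) :
    (p • (1 : W.CoordinateRing) + q • mk W X) * (r • 1 + s • mk W X) =
      (p * r + q * s * W.cubic) • 1 + (p * s + q * r) • mk W X := by
  have h := smul_basis_mul_Y (W' := W) p q
  rw [h₁, h₃] at h
  rw [mul_add, mul_smul_comm, mul_smul_comm, h, mul_one, cubic]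
  simp only [smul_add, smul_smul, C_0, zero_mul, zero_add, mul_zero, sub_zero, add_smul]
  simp only [Algebra.smul_def, map_mul]
  ring

theorem smul_basis_injective {p q r s : K[X]}
    (h : p • (1 : W.CoordinateRing) + q • mk W X = r • 1 + s • mk W X) : p = r ∧ q = s := by
  have := smul_basis_eq_zero (W' := W) (p := p - r) (q := q - s) (by
    rw [sub_smul, sub_smul, sub_add_sub_comm, h, sub_self])
  exact ⟨sub_eq_zero.1 this.1, sub_eq_zero.1 this.2⟩

variable (W) in
/-- The linear map underlying the derivation `2y d/dx` of the coordinate ring. -/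
noncomputable def derivAux : W.CoordinateRing →ₗ[K] W.CoordinateRing where
  toFun z := (2 * W.cubic * derivative ((CoordinateRing.basis W).repr z 1) +
      derivative W.cubic * (CoordinateRing.basis W).repr z 1) • 1 +
    (2 * derivative ((CoordinateRing.basis W).repr z 0)) • mk W X
  map_add' y z := by
    simp only [map_add, Finsupp.add_apply, Algebra.smul_def, map_mul]
    ring
  map_smul' c z := by
    rw [← algebraMap_smul K[X] c z, map_smul, ← algebraMap_smul K[X] (RingHom.id K c)]
    simp only [Finsupp.smul_apply, smul_eq_mul, algebraMap_eq, derivative_C_mul, RingHom.id_apply,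
      Algebra.smul_def, map_mul, map_add]
    ring

theorem derivAux_apply (p q : K[X]) : derivAux W (p • 1 + q • mk W X) =
    (2 * W.cubic * derivative q + derivative W.cubic * q) • 1 +
      (2 * derivative p) • mk W X := by
  have h0 : (CoordinateRing.basis W).repr (p • 1 + q • mk W X) 0 = p := by
    rw [← basis_zero, ← basis_one, map_add, map_smul, map_smul, Module.Basis.repr_self,
      Module.Basis.repr_self]
    simp
  have h1 : (CoordinateRing.basis W).repr (p • 1 + q • mk W X) 1 = q := by
    rw [← basis_zero, ← basis_one, map_add, map_smul, map_smul, Module.Basis.repr_self,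
      Module.Basis.repr_self]
    simp
  simp only [derivAux, LinearMap.coe_mk, AddHom.coe_mk, h0, h1]

/-- The derivation `2y d/dx` of the coordinate ring of `y² = x³ + a₂x² + a₄x + a₆`, dual to the
invariant differential. -/
noncomputable def deriv (h₁ : W.a₁ = 0) (h₃ : W.a₃ = 0) :
    Derivation K W.CoordinateRing W.CoordinateRing :=
  Derivation.mk' (derivAux W) fun a b => by
    obtain ⟨p, q, rfl⟩ := exists_smul_basis_eq a
    obtain ⟨r, s, rfl⟩ := exists_smul_basis_eq b
    simp only [mul_smul_basis h₁ h₃, derivAux_apply, smul_eq_mul]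
    rw [← sub_eq_zero]
    simp only [derivative_mul, map_ofNat, Algebra.smul_def, map_mul, map_add]
    ring

theorem deriv_apply (h₁ : W.a₁ = 0) (h₃ : W.a₃ = 0) (p q : K[X]) :
    deriv h₁ h₃ (p • 1 + q • mk W X) =
      (2 * W.cubic * derivative q + derivative W.cubic * q) • 1 +
        (2 * derivative p) • mk W X :=
  derivAux_apply p q

theorem deriv_smul_one (h₁ : W.a₁ = 0) (h₃ : W.a₃ = 0) (p : K[X]) :
    deriv h₁ h₃ (p • 1) = (2 * derivative p) • mk W X := by
  simpa using deriv_apply h₁ h₃ p 0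

theorem derivation_smul_one (Δ : Derivation K W.CoordinateRing W.CoordinateRing) (p : K[X]) :
    Δ (p • 1) = derivative p • Δ ((X : K[X]) • 1) := by
  have := Δ.map_aeval p (algebraMap K[X] W.CoordinateRing X)
  rw [aeval_algebraMap_apply, aeval_algebraMap_apply, aeval_X_left_apply, aeval_X_left_apply,
    smul_eq_mul] at this
  simpa only [Algebra.smul_def, mul_one] using this

/-- The derivations of the coordinate ring form a module of rank one. -/
theorem derivation_proportional (h₁ : W.a₁ = 0) (h₃ : W.a₃ = 0)
    (Δ : Derivation K W.CoordinateRing W.CoordinateRing) (z : W.CoordinateRing) :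
    2 * mk W X * Δ z = Δ ((X : K[X]) • 1) * deriv h₁ h₃ z := by
  have hy : mk W X * mk W X = W.cubic • 1 := by
    simpa using mul_smul_basis (W := W) h₁ h₃ 0 1 0 1
  have hΔy : 2 * mk W X * Δ (mk W X) = derivative W.cubic • Δ ((X : K[X]) • 1) := by
    rw [← derivation_smul_one, ← hy, Δ.leibniz, smul_eq_mul]
    ring
  obtain ⟨p, q, rfl⟩ := exists_smul_basis_eq z
  have hq : q • mk W X = (q • (1 : W.CoordinateRing)) * mk W X := by simp
  rw [map_add, deriv_apply, hq, Δ.leibniz, derivation_smul_one Δ p, derivation_smul_one Δ q]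
  simp only [smul_eq_mul, Algebra.smul_def, map_mul, map_add, map_ofNat, mul_one] at *
  linear_combination (algebraMap K[X] W.CoordinateRing q) * hΔy +
    2 * algebraMap K[X] W.CoordinateRing (derivative q) *
      Δ (algebraMap K[X] W.CoordinateRing X) * hy

end CoordinateRing

variable {W}

theorem natDegree_cubic : W.cubic.natDegree = 3 := by
  rw [cubic, ← one_mul (X ^ 3 : K[X]), ← C_1]
  exact Polynomial.natDegree_cubic one_ne_zero

theorem cubic_ne_zero : W.cubic ≠ 0 := fun h => by
  simpa [h] using natDegree_cubic (W := W)

/-- If `q y` is killed by the derivation `2y d/dx` in characteristic `2n + 1`, then `q` is divisible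
by a high power of the cubic. -/
theorem cubic_pow_dvd {n : ℕ} (hn : ∀ k < n, ((2 * k + 1 : ℕ) : K) ≠ 0)
    (hsep : IsCoprime W.cubic (derivative W.cubic)) {q : K[X]}
    (hq : 2 * W.cubic * derivative q + derivative W.cubic * q = 0) {k : ℕ} (hk : k ≤ n) :
    W.cubic ^ k ∣ q := by
  induction k with
  | zero => simp
  | succ k ih =>
    obtain ⟨r, rfl⟩ := ih (by omega)
    have hd : W.cubic * derivative (W.cubic ^ k) =
        (k : K[X]) * W.cubic ^ k * derivative W.cubic := by
      rcases k with _ | k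
      · simp
      · rw [derivative_pow, map_natCast]
        simp only [add_tsub_cancel_right]
        ring
    -- Substituting q = f^k r and cancelling f^k leaves (2k+1) f' r + 2 f r' = 0. As 2k+1 is
    -- invertible and f is coprime to f', one more factor f divides r.
    have h : W.cubic ^ k * (((2 * k + 1 : ℕ) : K[X]) * (derivative W.cubic * r) +
        W.cubic * (2 * derivative r)) = 0 := by
      rw [← hq, derivative_mul]
      push_cast
      linear_combination -2 * r * hd
    have h' := (mul_eq_zero.1 h).resolve_left (pow_ne_zero _ cubic_ne_zero)
    have hdvd : W.cubic ∣ ((2 * k + 1 : ℕ) : K[X]) * (derivative W.cubic * r) :=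
      ⟨-(2 * derivative r), by linear_combination h'⟩
    have hu : IsUnit ((2 * k + 1 : ℕ) : K[X]) := by
      rw [← map_natCast C]
      exact isUnit_C.2 (isUnit_iff_ne_zero.2 (hn k (by omega)))
    rw [pow_succ]
    exact mul_dvd_mul_left _ (hsep.dvd_of_dvd_mul_left (hu.dvd_mul_left.1 hdvd))

namespace CoordinateRing

theorem natDegree_norm_le_iff (p q : K[X]) (e : ℕ) :
    (Algebra.norm K[X] (p • (1 : W.CoordinateRing) + q • mk W X)).natDegree ≤ e ↔
      2 * p.natDegree ≤ e ∧ (q = 0 ∨ 2 * q.natDegree + 3 ≤ e) := by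
  rw [natDegree_le_iff_degree_le, degree_norm_smul_basis, max_le_iff]
  refine and_congr ?_ ?_
  · by_cases hp : p = 0
    · simp [hp]
    · rw [degree_eq_natDegree hp, nsmul_eq_mul]
      norm_cast
  · by_cases hq : q = 0
    · simp [hq]
    · rw [degree_eq_natDegree hq, nsmul_eq_mul, or_iff_right hq]
      norm_cast

theorem norm_ne_zero {z : W.CoordinateRing} (hz : z ≠ 0) : Algebra.norm K[X] z ≠ 0 :=
  have : Module.Finite K[X] W.CoordinateRing := .of_basis (CoordinateRing.basis W)
  Algebra.norm_ne_zero_iff.2 hz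

/-- The degree of the norm is the pole order at infinity, where x and y have orders 2 and 3. Since
Dx = 2y and Dy = f', D raises it by at most one. -/
theorem natDegree_norm_deriv_le (h₁ : W.a₁ = 0) (h₃ : W.a₃ = 0) (z : W.CoordinateRing) :
    (Algebra.norm K[X] (deriv h₁ h₃ z)).natDegree ≤ (Algebra.norm K[X] z).natDegree + 1 := by
  obtain ⟨p, q, rfl⟩ := exists_smul_basis_eq z
  obtain ⟨hp, hq⟩ := (natDegree_norm_le_iff (W := W) p q _).1 le_rfl
  rw [deriv_apply, natDegree_norm_le_iff]
  generalize (Algebra.norm K[X] (p • (1 : W.CoordinateRing) + q • mk W X)).natDegree = d at *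
  constructor
  · rcases hq with rfl | hq
    · simp
    · have h : (2 * W.cubic * derivative q + derivative W.cubic * q).natDegree ≤
          q.natDegree + 2 := by
        refine (natDegree_add_le _ _).trans (max_le ?_ ?_)
        · by_cases h0 : q.natDegree = 0
          · rw [eq_C_of_natDegree_eq_zero h0]
            simp
          · refine natDegree_mul_le.trans ?_
            have h1 : (2 * W.cubic).natDegree ≤ 3 := by
              rw [← natDegree_cubic (W := W), ← C_ofNat]
              exact natDegree_C_mul_le _ _
            have h2 := natDegree_derivative_le q
            omega
        · refine natDegree_mul_le.trans ?_
          have h2 := natDegree_derivative_le W.cubic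
          rw [natDegree_cubic] at h2
          omega
      omega
  · by_cases hd : derivative p = 0
    · simp [hd]
    · right
      have h0 : p.natDegree ≠ 0 := fun h0 => hd <| by
        rw [eq_C_of_natDegree_eq_zero h0, derivative_C]
      have h1 : (2 * derivative p).natDegree ≤ p.natDegree - 1 := by
        rw [← C_ofNat]
        exact (natDegree_C_mul_le _ _).trans (natDegree_derivative_le p)
      omega

/-- A function dividing its own derivative satisfies a first order equation with constant
coefficients. -/
theorem exists_deriv_eq_smul (h₁ : W.a₁ = 0) (h₃ : W.a₃ = 0) {g : W.CoordinateRing} (hg : g ≠ 0)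
    (h : g ∣ deriv h₁ h₃ g) : ∃ c : K, deriv h₁ h₃ g = c • g := by
  obtain ⟨z, hz⟩ := h
  by_cases hz0 : z = 0
  · exact ⟨0, by simp [hz, hz0]⟩
  have hle := natDegree_norm_deriv_le h₁ h₃ g
  -- The cofactor z has pole order at most 1. No function has order exactly 1, so z is constant.
  rw [hz, map_mul, natDegree_mul (norm_ne_zero hg) (norm_ne_zero hz0), add_le_add_iff_left] at hle
  obtain ⟨p, q, rfl⟩ := exists_smul_basis_eq z
  obtain ⟨hp, hq⟩ := (natDegree_norm_le_iff (W := W) p q _).1 hle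
  obtain rfl : q = 0 := hq.resolve_right (by omega)
  refine ⟨p.coeff 0, ?_⟩
  rw [hz, eq_C_of_natDegree_eq_zero (show p.natDegree = 0 by omega)]
  simp only [coeff_C_zero, zero_smul, add_zero, mul_smul_comm, mul_one]
  rw [← algebraMap_smul K[X] (p.coeff 0) g, algebraMap_eq]

/-! ### The p-torsion criterion -/

variable {p : ℕ} [Fact p.Prime] [CharP K p]

omit [Fact p.Prime] in
theorem charP_coordinateRing : CharP W.CoordinateRing p :=
  charP_of_injective_algebraMap (FaithfulSMul.algebraMap_injective K W.CoordinateRing) p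

theorem Y_pow (h₁ : W.a₁ = 0) (h₃ : W.a₃ = 0) (n : ℕ) :
    mk W X ^ (2 * n + 1) = W.cubic ^ n • mk W X := by
  have hy : mk W X * mk W X = W.cubic • 1 := by
    simpa using mul_smul_basis (W := W) h₁ h₃ 0 1 0 1
  rw [pow_succ, pow_mul, sq, hy, _root_.smul_pow, one_pow, smul_mul_assoc, one_mul]

/-- If the Hasse invariant vanishes, then the derivation `2y d/dx` has no nonzero eigenvalue. -/
theorem eigenvalue_eq_zero (hp : Odd p) (h₁ : W.a₁ = 0) (h₃ : W.a₃ = 0) {w : K[X]}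
    (hw : derivative w = W.cubic ^ ((p - 1) / 2)) {g : W.CoordinateRing} (hg : g ≠ 0) {c : K}
    (hc : deriv h₁ h₃ g = c • g) : c = 0 := by
  have := charP_coordinateRing (W := W) (p := p)
  have hpp : p.Prime := Fact.out
  have hpn : 2 * ((p - 1) / 2) + 1 = p := by obtain ⟨k, rfl⟩ := hp; omega
  have h2 : (2 : W.CoordinateRing) ≠ 0 := by
    have := (CharP.cast_eq_zero_iff W.CoordinateRing p 2).not.2 fun h => by
      have := Nat.le_of_dvd two_pos h
      have := hpp.two_le
      obtain ⟨k, rfl⟩ := hp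
      omega
    exact_mod_cast this
  have hy0 : mk W X ≠ 0 := by simpa [YClass] using YClass_ne_zero (W' := W) 0
  have hDw : deriv h₁ h₃ (w • 1) = 2 * mk W X ^ p := by
    rw [deriv_smul_one, hw, mul_smul, ← Y_pow h₁ h₃, hpn, Algebra.smul_def, map_ofNat]
  set Δ := (deriv (W := W) h₁ h₃).iterateChar p with hΔ
  -- D²w = D(2y^p) = 0 and p ≥ 2. Since Dw ≠ 0, proportionality of Δ = D^p to D then forces Δ = 0.
  have hΔw : Δ (w • 1) = 0 := by
    obtain ⟨k, hk⟩ := Nat.exists_eq_add_of_le hpp.two_le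
    rw [hΔ, Derivation.iterateChar_apply]
    conv_lhs => rw [hk, add_comm, Function.iterate_add_apply]
    have : (deriv (W := W) h₁ h₃)^[2] (w • 1) = 0 := by
      simp only [Function.iterate_succ, Function.iterate_zero, Function.comp_apply, id_eq]
      rw [hDw, ← Nat.cast_ofNat, ← nsmul_eq_mul, map_nsmul, Derivation.map_pow_char, smul_zero]
    rw [this]
    exact Function.iterate_fixed (map_zero _) k
  have hΔx : Δ ((X : K[X]) • 1) = 0 := by
    have h := derivation_proportional h₁ h₃ Δ (w • 1)
    rw [hΔw, mul_zero, hDw, eq_comm] at h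
    exact (mul_eq_zero.1 h).resolve_right (mul_ne_zero h2 (pow_ne_zero _ hy0))
  have hΔg : Δ g = 0 := by
    have h := derivation_proportional h₁ h₃ Δ g
    rw [hΔx, zero_mul] at h
    exact (mul_eq_zero.1 h).resolve_left (mul_ne_zero h2 hy0)
  have hiter : ∀ k : ℕ, (deriv (W := W) h₁ h₃)^[k] g = c ^ k • g := fun k => by
    induction k with
    | zero => simp
    | succ k ih =>
      rw [Function.iterate_succ_apply', ih, Derivation.map_smul, hc, smul_smul, pow_succ]
  rw [hΔ, Derivation.iterateChar_apply, hiter] at hΔg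
  exact pow_eq_zero_iff hpp.ne_zero |>.1 ((smul_eq_zero.1 hΔg).resolve_right hg)

theorem XYIdeal_ne_top {x y : K} (h : W.Equation x y) : XYIdeal W x (C y) ≠ ⊤ := fun ht => by
  have e := quotientXYIdealEquiv (W' := W) (y := C y) h
  have : Subsingleton (W.CoordinateRing ⧸ XYIdeal W x (C y)) := Ideal.Quotient.subsingleton_iff.2 ht
  exact not_subsingleton K e.symm.injective.subsingleton

/-- If the Hasse invariant vanishes, then the `p`-th power of the ideal of a point is not
principal. -/
theorem XYIdeal_pow_ne_span (hp : Odd p) (h₁ : W.a₁ = 0) (h₃ : W.a₃ = 0)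
    (hsep : IsCoprime W.cubic (derivative W.cubic)) {w : K[X]}
    (hw : derivative w = W.cubic ^ ((p - 1) / 2)) {x y : K} (hxy : W.Nonsingular x y)
    {g : W.CoordinateRing} (hg : g ≠ 0) : XYIdeal W x (C y) ^ p ≠ Ideal.span {g} := fun h => by
  have hpp : p.Prime := Fact.out
  have hpn : 2 * ((p - 1) / 2) + 1 = p := by obtain ⟨k, rfl⟩ := hp; omega
  have := charP_coordinateRing (W := W) (p := p)
  obtain ⟨c, hc⟩ := exists_deriv_eq_smul h₁ h₃ hg
    (Derivation.dvd_apply_of_span_pair_pow _ hg h)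
  obtain rfl := eigenvalue_eq_zero hp h₁ h₃ hw hg hc
  obtain ⟨a, b, rfl⟩ := exists_smul_basis_eq g
  rw [zero_smul, deriv_apply] at hc
  obtain ⟨hb, ha⟩ := smul_basis_eq_zero hc
  obtain ⟨z, hz⟩ : a • 1 + b • mk W X ∣ XClass W x ^ p := Ideal.mem_span_singleton.1 <|
    h ▸ Ideal.pow_mem_pow (Ideal.subset_span (Set.mem_insert _ _)) p
  have hXx : XClass W x ^ p = ((X - C x) ^ p) • (1 : W.CoordinateRing) := by
    rw [XClass, smul, map_pow, map_pow, mul_one]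
  have hN : (Algebra.norm K[X] (a • (1 : W.CoordinateRing) + b • mk W X)).natDegree ≤ 2 * p := by
    have hle : (Algebra.norm K[X] (XClass W x ^ p)).natDegree ≤ 2 * p := by
      have := (natDegree_norm_le_iff (W := W) ((X - C x) ^ p) 0 (2 * p)).2 (by simp)
      rwa [zero_smul, add_zero, ← hXx] at this
    refine le_trans ?_ hle
    refine natDegree_le_of_dvd ⟨_, by rw [hz, map_mul]⟩ (norm_ne_zero ?_)
    exact pow_ne_zero _ (XClass_ne_zero x)
  have hne : ∀ k < (p - 1) / 2, ((2 * k + 1 : ℕ) : K) ≠ 0 := fun k hk => by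
    rw [Ne, CharP.cast_eq_zero_iff K p]
    exact Nat.not_dvd_of_pos_of_lt (by omega) (by omega)
  -- If b ≠ 0, then f^((p-1)/2) ∣ b, so the norm of g has degree at least 3(p-1) + 3 = 3p. But g
  -- divides (x - x₀)^p, whose norm has degree 2p.
  obtain rfl : b = 0 := by
    by_contra hb0
    have h1 := natDegree_le_of_dvd (cubic_pow_dvd hne hsep hb le_rfl) hb0
    rw [natDegree_pow, natDegree_cubic] at h1
    have h2 := (((natDegree_norm_le_iff a b _).1 hN).2).resolve_left hb0
    omega
  simp only [zero_smul, add_zero] at h hz hg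
  have hdvd : a ∣ (X - C x) ^ p := by
    obtain ⟨r, s, rfl⟩ := exists_smul_basis_eq z
    rw [hXx] at hz
    have := (smul_basis_injective (W := W) (p := (X - C x) ^ p) (q := 0) (r := a * r) (s := a * s)
      (by rw [zero_smul, add_zero, hz]; simp only [Algebra.smul_def, map_mul]; ring)).1
    exact ⟨r, this⟩
  obtain ⟨i, hip, u, hu⟩ := (dvd_prime_pow (prime_X_sub_C x) p).1 hdvd
  have hu' : a * (u : K[X]) = (X - C x) ^ i := hu
  have hspan : Ideal.span {a • (1 : W.CoordinateRing)} = XIdeal W x ^ i := by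
    rw [XIdeal, Ideal.span_singleton_pow, Ideal.span_singleton_eq_span_singleton]
    refine ⟨Units.map (algebraMap K[X] W.CoordinateRing).toMonoidHom u, ?_⟩
    have := congrArg (algebraMap K[X] W.CoordinateRing) hu'
    rw [map_mul, map_pow] at this
    rw [Algebra.smul_def, mul_one]
    exact this
  -- The polynomial a is a scalar multiple of (X - x₀)^i, and a' = 0.
  have hi : p ∣ i := by
    rw [← CharP.cast_eq_zero_iff K p]
    by_contra hi0
    have h2 : (2 : K[X]) ≠ 0 := by
      rw [← C_ofNat, Ne, C_eq_zero]
      have := (CharP.cast_eq_zero_iff K p 2).not.2 fun h => by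
        have := Nat.le_of_dvd two_pos h
        have := hpp.two_le
        omega
      exact_mod_cast this
    have hd : derivative ((X - C x) ^ i) = 0 := by
      obtain ⟨k, -, hk⟩ := Polynomial.isUnit_iff.1 u.isUnit
      rw [← hu', ← hk, mul_comm, derivative_C_mul, (mul_eq_zero.1 ha).resolve_left h2, mul_zero]
    rw [derivative_X_sub_C_pow] at hd
    rcases mul_eq_zero.1 hd with h | h
    · exact hi0 (C_eq_zero.1 h)
    · exact pow_ne_zero _ (X_sub_C_ne_zero x) h
  have hne_top := XYIdeal_ne_top hxy.1
  rw [hspan] at h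
  rcases Nat.eq_zero_or_pos i with rfl | hi0
  · rw [pow_zero, Ideal.one_eq_top, Ideal.pow_eq_top_iff] at h
    exact h.elim hne_top hpp.ne_zero
  · obtain rfl : i = p := le_antisymm hip (Nat.le_of_dvd hi0 hi)
    -- Case i = p: the ideals of P and -P multiply to (x - x₀), so I^p = (x - x₀)^p would make the
    -- p-th power of the ideal of -P the unit ideal.
    have hneg := XYIdeal_ne_top ((nonsingular_neg ..).2 hxy).1
    have h' := h
    rw [← XYIdeal_neg_mul hxy, mul_pow, h, XIdeal, Ideal.span_singleton_pow] at h'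
    have hmem : XClass W x ^ i ∈ XYIdeal W x (C (W.negY x y)) ^ i * Ideal.span {XClass W x ^ i} :=
      h' ▸ Ideal.mem_span_singleton_self _
    obtain ⟨t, ht, htx⟩ := Ideal.mem_mul_span_singleton.1 hmem
    rw [mul_eq_right₀ (pow_ne_zero _ (XClass_ne_zero x))] at htx
    rw [htx, ← Ideal.eq_top_iff_one, Ideal.pow_eq_top_iff] at ht
    exact ht.elim hneg hpp.ne_zero

end CoordinateRing

/-- A criterion for supersingularity: if `f ^ ((p - 1) / 2)` has an antiderivative, then
`y² = f(x)` has no nontrivial `p`-torsion. -/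
theorem Point.eq_zero_of_char_smul_eq_zero {p : ℕ} [Fact p.Prime] [CharP K p] [DecidableEq K]
    (hp : Odd p) (h₁ : W.a₁ = 0) (h₃ : W.a₃ = 0)
    (hsep : IsCoprime W.cubic (derivative W.cubic)) {w : K[X]}
    (hw : derivative w = W.cubic ^ ((p - 1) / 2)) (P : W.Point) (hP : p • P = 0) : P = 0 := by
  rcases P with _ | ⟨x, y, h⟩
  · rfl
  exfalso
  have hcl := congrArg toClass hP
  rw [map_nsmul, toClass_zero, toClass_some] at hcl
  have hcl' : ClassGroup.mk W.FunctionField (CoordinateRing.XYIdeal' (W := W) h ^ p) = 1 := by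
    rw [map_pow]
    exact hcl
  obtain ⟨g, hg, hpow⟩ := (ClassGroup.mk_eq_one_of_coe_ideal
    (I' := CoordinateRing.XYIdeal W x (C y) ^ p) (by
      rw [Units.val_pow_eq_pow_val, CoordinateRing.XYIdeal'_eq,
        FractionalIdeal.coeIdeal_pow])).1 hcl'
  exact CoordinateRing.XYIdeal_pow_ne_span hp h₁ h₃ hsep hw h hg hpow

end WeierstrassCurve.Affine

/-- In characteristic `p`, a polynomial of degree less than `2p - 1` whose coefficient of
`x ^ (p - 1)` vanishes has an antiderivative. -/
theorem Polynomial.exists_derivative_eq_of_coeff_eq_zero {K : Type*} [Field K] {p : ℕ} [CharP K p]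
    {F : K[X]} (hdeg : F.natDegree < 2 * p - 1) (h : F.coeff (p - 1) = 0) :
    ∃ w, derivative w = F := by
  refine ⟨∑ i ∈ Finset.range (2 * p - 1), monomial (i + 1) (F.coeff i / ((i + 1 : ℕ) : K)), ?_⟩
  rw [derivative_sum]
  conv_rhs => rw [F.as_sum_range' _ hdeg]
  refine Finset.sum_congr rfl fun i hi => ?_
  rw [derivative_monomial, add_tsub_cancel_right]
  by_cases hi0 : ((i + 1 : ℕ) : K) = 0
  -- Since i + 1 < 2p, the only exponent not invertible in K is i + 1 = p, where the coefficient of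
  -- F vanishes by hypothesis.
  · obtain ⟨c, hc⟩ := (CharP.cast_eq_zero_iff K p _).1 hi0
    have hlt := Finset.mem_range.1 hi
    obtain rfl : c = 1 := by
      have h0 : c ≠ 0 := by rintro rfl; omega
      have h2 : c < 2 := by
        by_contra! h2
        have := Nat.mul_le_mul_left p h2
        omega
      omega
    rw [show i = p - 1 by omega, h, zero_div, zero_mul]
  · rw [div_mul_cancel₀ _ hi0]

/-! ### The Deuring polynomial -/

theorem coeff_deuringPolynomial (ℓ k : ℕ) :
    (deuringPolynomial ℓ).coeff k = (((ℓ - 1) / 2).choose k : ZMod ℓ) ^ 2 := by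
  rw [deuringPolynomial, finsetSum_coeff]
  simp only [coeff_C_mul_X_pow]
  rw [Finset.sum_ite_eq]
  split_ifs with h
  · rfl
  · rw [Nat.choose_eq_zero_of_lt (by simpa using h)]
    simp

theorem natDegree_deuringPolynomial_le (ℓ : ℕ) :
    (deuringPolynomial ℓ).natDegree ≤ (ℓ - 1) / 2 := by
  rw [natDegree_le_iff_coeff_eq_zero]
  intro k hk
  rw [coeff_deuringPolynomial, Nat.choose_eq_zero_of_lt hk]
  simp

theorem deuringPolynomial_eval_zero (ℓ : ℕ) : (deuringPolynomial ℓ).eval 0 = 1 := by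
  rw [← coeff_zero_eq_eval_zero, coeff_deuringPolynomial]
  simp

/-- The hypergeometric differential equation of the Deuring polynomial. -/
theorem deuringPolynomial_differential_equation {ℓ : ℕ} (hℓ : Odd ℓ) :
    4 * X * (1 - X) * derivative (derivative (deuringPolynomial ℓ)) +
      4 * (1 - 2 * X) * derivative (deuringPolynomial ℓ) - deuringPolynomial ℓ = 0 := by
  have hrec (k : ℕ) : 4 * ((k : ZMod ℓ) + 1) ^ 2 * (deuringPolynomial ℓ).coeff (k + 1) =
      (2 * k + 1) ^ 2 * (deuringPolynomial ℓ).coeff k := by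
    simp only [coeff_deuringPolynomial]
    obtain ⟨n, rfl⟩ := hℓ
    rw [show (2 * n + 1 - 1) / 2 = n by omega]
    have hz : (2 * n + 1 : ZMod (2 * n + 1)) = 0 := by exact_mod_cast ZMod.natCast_self (2 * n + 1)
    -- Since 2n = -1, the factor 2(n - k) in the binomial recursion becomes -(2k + 1). Squaring
    -- gives the recursion for the coefficients of H.
    have h : 2 * (n.choose (k + 1) : ZMod (2 * n + 1)) * (k + 1) = -(n.choose k * (2 * k + 1)) := by
      rcases le_or_gt k n with hk | hk
      · have := congrArg (Nat.cast : ℕ → ZMod (2 * n + 1)) (Nat.choose_succ_right_eq n k)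
        push_cast [Nat.cast_sub hk] at this
        linear_combination 2 * this + (n.choose k : ZMod (2 * n + 1)) * hz
      · rw [Nat.choose_eq_zero_of_lt hk, Nat.choose_eq_zero_of_lt (by omega)]
        simp
    linear_combination (2 * (n.choose (k + 1) : ZMod (2 * n + 1)) * (k + 1) -
      (n.choose k * (2 * k + 1))) * h
  set H := deuringPolynomial ℓ
  rw [show 4 * X * (1 - X) * derivative (derivative H) + 4 * (1 - 2 * X) * derivative H - H =
    C 4 * (X * derivative (derivative H)) - C 4 * (X * (X * derivative (derivative H))) +
      C 4 * derivative H - C 8 * (X * derivative H) - H by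
    simp only [map_ofNat]; ring]
  ext k
  simp only [coeff_add, coeff_sub, coeff_C_mul, coeff_zero]
  rcases k with _ | _ | k
  · have := hrec 0
    simp [coeff_derivative] at this ⊢
    linear_combination this
  · have := hrec 1
    simp [coeff_X_mul, coeff_derivative] at this ⊢
    linear_combination this
  · have := hrec (k + 2)
    simp only [coeff_X_mul, coeff_derivative] at this ⊢
    push_cast at this ⊢
    linear_combination this

/-- `1/2` is not a multiple root of the Deuring polynomial. -/
theorem not_sq_dvd_deuringPolynomial {ℓ : ℕ} [Fact ℓ.Prime] (hℓ : Odd ℓ) {r : ZMod ℓ}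
    (hr : 2 * r = 1) : ¬ (X - C r) ^ 2 ∣ deuringPolynomial ℓ := fun h => by
  have hode := deuringPolynomial_differential_equation hℓ
  have hdeg := natDegree_deuringPolynomial_le ℓ
  have hpos : 0 < ℓ := (Fact.out : ℓ.Prime).pos
  have hH : deuringPolynomial ℓ ≠ 0 := fun h0 => by
    simpa [h0] using deuringPolynomial_eval_zero ℓ
  generalize deuringPolynomial ℓ = H at *
  have hm := (le_rootMultiplicity_iff hH).2 h
  obtain ⟨Q, hQ, hnQ⟩ := exists_eq_pow_rootMultiplicity_mul_and_not_dvd H hH r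
  have hle : rootMultiplicity r H ≤ H.natDegree := by
    have := natDegree_le_of_dvd (pow_rootMultiplicity_dvd H r) hH
    rwa [natDegree_pow, natDegree_X_sub_C, mul_one] at this
  obtain ⟨j, hj⟩ := Nat.exists_eq_add_of_le' hm
  rw [hj] at hQ hle
  have hr' : (2 * C r : (ZMod ℓ)[X]) = 1 := by rw [← C_ofNat, ← C_mul, hr, C_1]
  -- The multiplicity j + 2 is at most (ℓ-1)/2 < ℓ, so (j+2)(j+1) is invertible.
  have hcast (k : ℕ) (h0 : 0 < k) (hk : k ≤ j + 2) : IsUnit (C (k : ZMod ℓ)) := by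
    rw [isUnit_C, isUnit_iff_ne_zero, Ne, ZMod.natCast_eq_zero_iff]
    exact Nat.not_dvd_of_pos_of_lt h0 (by omega)
  refine hnQ ?_
  set t : (ZMod ℓ)[X] := X - C r with ht
  have h1 (k : ℕ) : derivative (t ^ (k + 1)) = C ((k + 1 : ℕ) : ZMod ℓ) * t ^ k := by
    rw [ht, derivative_X_sub_C_pow, add_tsub_cancel_right]
  have hd : derivative H = C ((j + 2 : ℕ) : ZMod ℓ) * t ^ (j + 1) * Q +
      t ^ (j + 2) * derivative Q := by
    rw [hQ, derivative_mul, h1]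
  have hdd : derivative (derivative H) =
      C ((j + 2 : ℕ) : ZMod ℓ) * C ((j + 1 : ℕ) : ZMod ℓ) * t ^ j * Q +
        t ^ (j + 1) * (2 * C ((j + 2 : ℕ) : ZMod ℓ) * derivative Q +
          t * derivative (derivative Q)) := by
    rw [hd, derivative_add, derivative_mul, derivative_mul, derivative_mul, derivative_C, h1, h1]
    ring
  have hX : (X : (ZMod ℓ)[X]) = t + C r := by rw [ht]; ring
  -- The leading coefficient of the equation is 1 at t = 0, so the lowest term in t is (j+2)(j+1)
  -- t^j Q, which forces t ∣ Q.
  have hA : 4 * X * (1 - X) = 1 - 4 * t ^ 2 := by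
    rw [hX]
    linear_combination (-4 * t + 1 - 2 * C r) * hr'
  have hB : 4 * (1 - 2 * X) = -8 * t := by
    rw [hX]
    linear_combination -4 * hr'
  rw [hA, hB, hdd, hd, hQ] at hode
  generalize hQ1 : derivative Q = Q₁ at *
  generalize hQ2 : derivative Q₁ = Q₂ at *
  generalize hc : C ((j + 2 : ℕ) : ZMod ℓ) = c at *
  generalize hc' : C ((j + 1 : ℕ) : ZMod ℓ) = c' at *
  have hmul : t ^ j * (c * c' * Q + t * ((1 - 4 * t ^ 2) * (2 * c * Q₁ + t * Q₂) -
      4 * t * c * c' * Q - 8 * t * (c * Q + t * Q₁) - t * Q)) = 0 := by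
    linear_combination hode
  have hmul' := (mul_eq_zero.1 hmul).resolve_left (pow_ne_zero _ (X_sub_C_ne_zero r))
  have hdvd : t ∣ c * c' * Q := (dvd_add_left (Dvd.intro _ rfl)).1 (hmul' ▸ dvd_zero t)
  have hu : IsUnit (c * c') := by
    rw [← hc, ← hc']
    exact (hcast _ (by omega) le_rfl).mul (hcast _ (by omega) (by omega))
  exact hu.dvd_mul_left.1 hdvd

/-! ### Legendre and symmetric curves -/

section Legendre

variable {K : Type*} [Field K]

theorem cubic_legendreCurve (lam : K) :
    WeierstrassCurve.Affine.cubic (legendreCurve lam) = X * (X - 1) * (X - C lam) := by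
  simp only [WeierstrassCurve.Affine.cubic, legendreCurve, map_neg, map_add, map_one, map_zero]
  ring

theorem coeff_legendre_pow (lam : K) (n : ℕ) :
    ((X * (X - 1) * (X - C lam)) ^ n).coeff (2 * n) =
      (-1) ^ n * ∑ k ∈ Finset.range (n + 1), (n.choose k : K) ^ 2 * lam ^ k := by
  rw [mul_assoc, mul_pow, two_mul, coeff_X_pow_mul, mul_pow, coeff_mul,
    Finset.Nat.sum_antidiagonal_eq_sum_range_succ_mk, Finset.mul_sum]
  refine Finset.sum_congr rfl fun k hk => ?_
  have hk : k ≤ n := by have := Finset.mem_range.1 hk; omega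
  rw [← C_1, sub_eq_add_neg, sub_eq_add_neg, ← C_neg, ← C_neg, coeff_X_add_C_pow,
    coeff_X_add_C_pow, Nat.sub_sub_self hk, Nat.choose_symm hk,
    neg_pow lam]
  have : (-1 : K) ^ n = (-1) ^ (n - k) * (-1) ^ k := by rw [← pow_add, Nat.sub_add_cancel hk]
  rw [this]
  ring

theorem aeval_deuringPolynomial {ℓ : ℕ} [Algebra (ZMod ℓ) K] (lam : K) :
    aeval lam (deuringPolynomial ℓ) =
      ∑ k ∈ Finset.range ((ℓ - 1) / 2 + 1), (((ℓ - 1) / 2).choose k : K) ^ 2 * lam ^ k := by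
  simp [deuringPolynomial]

/-- The roots of the Deuring polynomial are the parameters for which the Hasse invariant of the
Legendre curve vanishes. -/
theorem exists_derivative_eq_legendre_pow {ℓ : ℕ} (hℓ : Odd ℓ) [Algebra (ZMod ℓ) K] [CharP K ℓ]
    {lam : K} (h : aeval lam (deuringPolynomial ℓ) = 0) :
    ∃ w, derivative w =
      (WeierstrassCurve.Affine.cubic (legendreCurve lam)) ^ ((ℓ - 1) / 2) := by
  obtain ⟨n, rfl⟩ := hℓ
  rw [aeval_deuringPolynomial] at h
  have hn : (2 * n + 1 - 1) / 2 = n := by omega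
  rw [hn] at h ⊢
  refine exists_derivative_eq_of_coeff_eq_zero (p := 2 * n + 1) ?_ ?_
  · rw [natDegree_pow, WeierstrassCurve.Affine.natDegree_cubic]
    omega
  · rw [cubic_legendreCurve, add_tsub_cancel_right, coeff_legendre_pow, h, mul_zero]

theorem isCoprime_cubic_legendreCurve {lam : K} (h0 : lam ≠ 0) (h1 : lam ≠ 1) :
    IsCoprime (WeierstrassCurve.Affine.cubic (legendreCurve lam))
      (derivative (WeierstrassCurve.Affine.cubic (legendreCurve lam))) := by
  have hX : (X : K[X]) = X - C 0 := by simp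
  change Separable _
  rw [cubic_legendreCurve, ← C_1]
  nth_rw 1 [hX]
  refine (separable_X_sub_C.mul separable_X_sub_C ?_).mul separable_X_sub_C
    (IsCoprime.mul_left ?_ ?_)
  · exact isCoprime_X_sub_C_of_isUnit_sub (by simp)
  · exact isCoprime_X_sub_C_of_isUnit_sub (by simpa using h0)
  · exact isCoprime_X_sub_C_of_isUnit_sub (by simpa [sub_eq_zero] using h1.symm)

variable {a lam : K}

/-- With t = x + 1 the symmetric cubic is t(t² + (b-3)t + 3 - b); with s = x - λ the Legendre cubic
is s(s² + (2λ-1)s + λ² - λ). The relations match coefficients under t = us, u = (2λ-1)/a, and rest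
on (2λ-1)² = 1 - 4a. -/
theorem symmetricCurve_relations (ha : a ≠ 0) (hlam : lam ^ 2 - lam + a = 0) :
    (2 * lam - 1) / a * (2 * lam - 1) = (1 - a) / a - 3 ∧
      ((2 * lam - 1) / a) ^ 2 * (lam ^ 2 - lam) = 3 - (1 - a) / a := by
  constructor <;> field_simp
  · linear_combination 4 * hlam
  · linear_combination (2 * lam - 1) ^ 2 * hlam - 4 * a * hlam

/-- The cubics defining the symmetric curve and the Legendre curve agree up to a linear change of
variable and a scalar. -/
theorem cubic_symmetricCurve (ha : a ≠ 0) (hlam : lam ^ 2 - lam + a = 0) (h2 : 2 * lam - 1 ≠ 0) :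
    WeierstrassCurve.Affine.cubic (symmetricCurve ((1 - a) / a)) =
      C (((2 * lam - 1) / a) ^ 3) * (WeierstrassCurve.Affine.cubic (legendreCurve lam)).comp
        (C (a / (2 * lam - 1)) * X + C (a / (2 * lam - 1) + lam)) := by
  obtain ⟨h₁, h₂⟩ := symmetricCurve_relations ha hlam
  have h₃ : (2 * lam - 1) / a * (a / (2 * lam - 1)) = 1 := by field_simp
  rw [cubic_legendreCurve]
  simp only [WeierstrassCurve.Affine.cubic, symmetricCurve]
  generalize (1 - a) / a = b at *
  generalize a / (2 * lam - 1) = v at *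
  generalize (2 * lam - 1) / a = u at *
  replace h₁ := congrArg C h₁
  replace h₂ := congrArg C h₂
  replace h₃ := congrArg C h₃
  simp only [mul_comp, sub_comp, X_comp, one_comp, C_comp, map_mul, map_sub, map_add, map_pow,
    map_ofNat, map_one] at *
  have h : C u ^ 3 * ((C v * X + (C v + C lam)) * (C v * X + (C v + C lam) - 1) *
      (C v * X + (C v + C lam) - C lam)) = (C u * C v * (X + 1) + C u * C lam) *
      (C u * C v * (X + 1) + C u * C lam - C u) * (C u * C v * (X + 1)) := by ring
  rw [h, h₃]
  linear_combination -(X + 1) ^ 2 * h₁ - (X + 1) * h₂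

theorem exists_variableChange_symmetricCurve [IsAlgClosed K] (ha : a ≠ 0)
    (hlam : lam ^ 2 - lam + a = 0) (h2 : 2 * lam - 1 ≠ 0) :
    ∃ V : WeierstrassCurve.VariableChange K,
      V • symmetricCurve ((1 - a) / a) = legendreCurve lam := by
  obtain ⟨u, hu⟩ := IsAlgClosed.exists_pow_nat_eq ((2 * lam - 1) / a) two_pos
  have hu0 : u ≠ 0 := by
    rintro rfl
    rw [zero_pow two_ne_zero, eq_comm, div_eq_zero_iff] at hu
    exact hu.elim h2 ha
  obtain ⟨h₁, h₂⟩ := symmetricCurve_relations ha hlam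
  rw [← hu] at h₁ h₂
  -- Here u² is the scaling ratio (2λ-1)/a, and the translation sends the root λ to the root -1.
  refine ⟨⟨Units.mk0 u hu0, -1 - u ^ 2 * lam, 0, 0⟩, ?_⟩
  generalize (1 - a) / a = b at *
  ext <;> simp only [WeierstrassCurve.variableChange_def, symmetricCurve, legendreCurve,
    Units.val_inv_eq_inv_val, Units.val_mk0, inv_pow, inv_mul_eq_iff_eq_mul₀ (pow_ne_zero _ hu0),
    inv_mul_eq_iff_eq_mul₀ hu0]
  · ring
  · linear_combination -h₁
  · ring
  · linear_combination 2 * u ^ 2 * lam * h₁ - h₂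
  · linear_combination -(u ^ 2 * lam) ^ 2 * h₁ + u ^ 2 * lam * h₂

theorem isCoprime_cubic_symmetricCurve (ha : a ≠ 0) (hlam : lam ^ 2 - lam + a = 0)
    (h2 : 2 * lam - 1 ≠ 0) :
    IsCoprime (WeierstrassCurve.Affine.cubic (symmetricCurve ((1 - a) / a)))
      (derivative (WeierstrassCurve.Affine.cubic (symmetricCurve ((1 - a) / a)))) := by
  have h0 : lam ≠ 0 := by rintro rfl; exact ha (by linear_combination hlam)
  have h1 : lam ≠ 1 := by rintro rfl; exact ha (by linear_combination hlam)
  have hu : IsUnit (C (((2 * lam - 1) / a) ^ 3)) :=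
    isUnit_C.2 (isUnit_iff_ne_zero.2 (pow_ne_zero _ (div_ne_zero h2 ha)))
  have hv : IsUnit (C (a / (2 * lam - 1))) :=
    isUnit_C.2 (isUnit_iff_ne_zero.2 (div_ne_zero ha h2))
  rw [cubic_symmetricCurve ha hlam h2, derivative_C_mul, isCoprime_mul_unit_left hu,
    derivative_comp]
  simp only [derivative_add, derivative_C_mul, derivative_X, derivative_C, mul_one, add_zero]
  rw [isCoprime_mul_unit_left_right hv]
  exact (isCoprime_cubic_legendreCurve h0 h1).map (compRingHom _)

theorem exists_derivative_eq_symmetric_pow {ℓ : ℕ} (hℓ : Odd ℓ) [Algebra (ZMod ℓ) K] [CharP K ℓ]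
    (ha : a ≠ 0) (hlam : lam ^ 2 - lam + a = 0) (h2 : 2 * lam - 1 ≠ 0)
    (h : aeval lam (deuringPolynomial ℓ) = 0) :
    ∃ w, derivative w =
      (WeierstrassCurve.Affine.cubic (symmetricCurve ((1 - a) / a))) ^ ((ℓ - 1) / 2) := by
  obtain ⟨w, hw⟩ := exists_derivative_eq_legendre_pow hℓ h
  rw [cubic_symmetricCurve ha hlam h2]
  have h₃ : (2 * lam - 1) / a * (a / (2 * lam - 1)) = 1 := by field_simp
  generalize a / (2 * lam - 1) = v at *
  generalize (2 * lam - 1) / a = u at *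
  refine ⟨C ((u ^ 3) ^ ((ℓ - 1) / 2) * u) * w.comp (C v * X + C (v + lam)), ?_⟩
  rw [derivative_C_mul, derivative_comp, hw, pow_comp, mul_pow, ← C_pow]
  simp only [derivative_add, derivative_C_mul, derivative_X, derivative_C, mul_one, add_zero]
  replace h₃ := congrArg C h₃
  rw [C_mul, C_1] at h₃
  rw [C_mul, mul_assoc, ← mul_assoc (C u), h₃, one_mul]

theorem isElliptic_symmetricCurve (ha : a ≠ 0) (ha4 : 1 - 4 * a ≠ 0) (h2 : (2 : K) ≠ 0) :
    (symmetricCurve ((1 - a) / a)).IsElliptic := by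
  have hΔ : (symmetricCurve ((1 - a) / a)).Δ = 2 ^ 4 * (1 - 4 * a) ^ 3 / a ^ 4 := by
    simp only [symmetricCurve, WeierstrassCurve.Δ, WeierstrassCurve.b₂, WeierstrassCurve.b₄,
      WeierstrassCurve.b₆, WeierstrassCurve.b₈]
    field_simp
    ring
  refine ⟨?_⟩
  rw [hΔ, isUnit_iff_ne_zero]
  exact div_ne_zero (mul_ne_zero (pow_ne_zero _ h2) (pow_ne_zero _ ha4)) (pow_ne_zero _ ha)

end Legendre

theorem symmetricCurve_baseChange {F K : Type*} [Field F] [Field K] [Algebra F K] (a : F) :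
    (symmetricCurve ((1 - a) / a)).baseChange K =
      symmetricCurve ((1 - algebraMap F K a) / algebraMap F K a) := by
  ext <;> simp [symmetricCurve]

theorem mainTheorem9 (ℓ : ℕ) [Fact ℓ.Prime] (hℓ : Odd ℓ) (a : ZMod ℓ)
    (ha : (X ^ 2 - X + C a : (ZMod ℓ)[X]) ∣ deuringPolynomial ℓ) :
    a ≠ 0 ∧
    IsSupersingularEllipticCurve ℓ (symmetricCurve ((1 - a) / a)) ∧
    (∃ lam : AlgebraicClosure (ZMod ℓ),
      lam ^ 2 - lam + algebraMap (ZMod ℓ) (AlgebraicClosure (ZMod ℓ)) a = 0) ∧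
    ∀ lam : AlgebraicClosure (ZMod ℓ),
      lam ^ 2 - lam + algebraMap (ZMod ℓ) (AlgebraicClosure (ZMod ℓ)) a = 0 →
        aeval lam (deuringPolynomial ℓ) = 0 ∧ lam ≠ 0 ∧ lam ≠ 1 ∧
        ∃ V : WeierstrassCurve.VariableChange (AlgebraicClosure (ZMod ℓ)),
          V • (symmetricCurve ((1 - a) / a)).baseChange (AlgebraicClosure (ZMod ℓ)) =
            legendreCurve lam := by
  have hl2 : ¬ ℓ ∣ 2 := fun h => by
    have := Nat.le_of_dvd two_pos h
    have := (Fact.out : ℓ.Prime).two_le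
    obtain ⟨k, rfl⟩ := hℓ
    omega
  have h2 : (2 : ZMod ℓ) ≠ 0 := by
    have := (ZMod.natCast_eq_zero_iff 2 ℓ).not.2 hl2
    exact_mod_cast this
  have ha0 : a ≠ 0 := by
    rintro rfl
    have := eval_dvd (x := (0 : ZMod ℓ)) ha
    rw [deuringPolynomial_eval_zero] at this
    simp at this
  have ha4 : 1 - 4 * a ≠ 0 := fun h => by
    have hr : (2 : ZMod ℓ) * 2⁻¹ = 1 := mul_inv_cancel₀ h2
    have hra : a = (2⁻¹ : ZMod ℓ) ^ 2 := by
      field_simp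
      linear_combination -h
    -- When 4a = 1, x² - x + a = (x - 1/2)².
    refine not_sq_dvd_deuringPolynomial hℓ hr ?_
    convert ha using 1
    have hr' := congrArg C hr
    rw [C_mul, C_ofNat, C_1] at hr'
    rw [hra, C_pow]
    linear_combination -X * hr'
  classical
  let K := AlgebraicClosure (ZMod ℓ)
  have hinj : Function.Injective (algebraMap (ZMod ℓ) K) := FaithfulSMul.algebraMap_injective _ _
  have : CharP K ℓ := charP_of_injective_algebraMap hinj ℓ
  have hA0 : algebraMap (ZMod ℓ) K a ≠ 0 := (_root_.map_ne_zero _).2 ha0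
  have h2K : (2 : K) ≠ 0 := by
    have := (CharP.cast_eq_zero_iff K ℓ 2).not.2 hl2
    exact_mod_cast this
  have hA4 : 1 - 4 * algebraMap (ZMod ℓ) K a ≠ 0 := fun h => ha4 <| hinj <| by
    rw [map_sub, map_mul, map_one, map_zero, ← h, map_ofNat (algebraMap (ZMod ℓ) K) 4]
  have hne {lam : K} (hlam : lam ^ 2 - lam + algebraMap (ZMod ℓ) K a = 0) : 2 * lam - 1 ≠ 0 :=
    fun h => hA4 (by linear_combination (2 * lam - 1) * h - 4 * hlam)
  have hroot {lam : K} (hlam : lam ^ 2 - lam + algebraMap (ZMod ℓ) K a = 0) :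
      aeval lam (deuringPolynomial ℓ) = 0 := by
    obtain ⟨Q, hQ⟩ := ha
    simp [hQ, hlam]
  have hex : ∃ lam : K, lam ^ 2 - lam + algebraMap (ZMod ℓ) K a = 0 := by
    obtain ⟨s, hs⟩ := IsAlgClosed.exists_pow_nat_eq (1 - 4 * algebraMap (ZMod ℓ) K a) two_pos
    have ht : 2 * ((1 + s) / 2) = 1 + s := mul_div_cancel₀ _ h2K
    refine ⟨(1 + s) / 2, mul_left_cancel₀ (mul_ne_zero h2K h2K) ?_⟩
    linear_combination (2 * ((1 + s) / 2) + s - 1) * ht + hs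
  refine ⟨ha0, ⟨isElliptic_symmetricCurve ha0 ha4 h2, ?_⟩, hex, fun lam hlam =>
    ⟨hroot hlam, ?_, ?_, ?_⟩⟩
  · obtain ⟨lam, hlam⟩ := hex
    rw [symmetricCurve_baseChange]
    obtain ⟨w, hw⟩ := exists_derivative_eq_symmetric_pow hℓ hA0 hlam (hne hlam) (hroot hlam)
    exact WeierstrassCurve.Affine.Point.eq_zero_of_char_smul_eq_zero hℓ rfl rfl
      (isCoprime_cubic_symmetricCurve hA0 hlam (hne hlam)) hw
  · rintro rfl
    exact hA0 (by linear_combination hlam)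
  · rintro rfl
    exact hA0 (by linear_combination hlam)
  · rw [symmetricCurve_baseChange]
    exact exists_variableChange_symmetricCurve hA0 hlam (hne hlam)
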